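/- Let $\Bbbk$ be an algebraically closed field of characteristic zero, and let $r,w\in\mathbb{N}_+$. A variety is an integral separated scheme of finite type over $\Bbbk$. Let $\pi:C\to S$ be an affine cone of varieties, i.e. an affine morphism of varieties with a grading $\mathcal{A}:=\pi_*\mathcal{O}_C=\bigoplus_{n\ge0}\mathcal{A}_n$ of quasi-coherent $\mathcal{O}_S$-algebras such that $\mathcal{A}_0=\mathcal{O}_S$; the grading is a $\mathbb{G}_m$-action on $C$. Let $Z\subseteq C$ be the zero section, with ideal $\mathcal{A}_{>0}$. Let $\mathbb{G}_a^r$ act on $C$ such that $\pi$ is invariant and such that the two actions form an action of $\mathbb{G}_a^r\rtimes_w\mathbb{G}_m$, where $\mathbb{G}_m$ acts on $\mathfrak{u}:=\mathrm{Lie}(\mathbb{G}_a^r)$ by scalar multiplication with weight $w$. Let $\mathcal{Q}(\pi)$ be the cokernel of the map $\Omega_{\mathcal{A}/\mathcal{A}_0}\to\mathfrak{u}^*\otimes\mathcal{A}$, $\mathrm{d}f\mapsto\sum_i u_i\otimes(\xi_i.f)$, where $\xi_1,\dots,\xi_r$ and $u_1,\dots,u_r$ are dual bases of $\mathfrak{u}$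 and $\mathfrak{u}^*$, and let $\mathrm{Fit}_m$ denote its $m$-th Fitting ideal. Put $$d(\pi):=\min_{z\in Z}\dim\mathrm{Stab}_{\mathfrak{u}}(z),\qquad e(\pi):=\min\{n\in\mathbb{N}:\mathrm{Fit}_{d(\pi)-1}(\mathcal{Q}(\pi))\cap\mathcal{A}_n\neq0\},$$ where $z$ runs over closed points and $e(\pi):=\infty$ if $\mathrm{Fit}_{d(\pi)-1}(\mathcal{Q}(\pi))=0$. Indices $(d,e)$ are compared lexicographically. Let $\mathcal{I}:=\mathrm{Fit}_{d(\pi)}(\mathcal{Q}(\pi))+\mathcal{A}_{>0}$, which is the ideal of the locus in $Z$ where $\dim\mathrm{Stab}_{\mathfrak{u}}>d(\pi)$, and let $\mathcal{J}:=\ker\big(\mathcal{A}\to\mathcal{O}(\mathbb{G}_a^r)\otimes\mathcal{A}/\mathcal{I}\big)$, the ideal of the closure of the $\mathbb{G}_a^r$-sweep of that locus. Let $\pi':C'\to S'$ be the result of Modification I, i.e. the modification of $\pi$ along $\mathcal{J}$: $C'$ is the open stratum of the Białynicki-Birula stratification (with respect to limits as $t\to0$) for the induced $\mathbb{G}_m$-action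 on the blow-up $\mathrm{Bl}_{\mathcal{J}}(C)$, and $\pi'$ is again an affine cone of varieties with an action of $\mathbb{G}_a^r\rtimes_w\mathbb{G}_m$ as above, such that $p:C'\to C$ is equivariant and there is $q:S'\to S$ with $\pi\circ p=q\circ\pi'$. Then $$(d(\pi'),e(\pi'))\le(d(\pi),e(\pi)),$$ and in fact equality holds. -/

import Mathlib

open CategoryTheory AlgebraicGeometry Opposite

universe u

noncomputable section

namespace GradedAdditive

/-- `X` is a variety over the field `k`: an integral scheme (reduced, irreducible, non-empty),
separated and of finite type over `k`. -/
structure IsVariety {k : Type u} [Field k] {X : Scheme.{u}}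
    (f : X ⟶ Spec (CommRingCat.of k)) : Prop where
  isIntegral : IsIntegral X
  isSeparated : IsSeparated f
  locallyOfFiniteType : LocallyOfFiniteType f
  quasiCompact : QuasiCompact f

/-- An affine cone of varieties `π : C ⟶ S` over `k`: an affine morphism, together with an
`ℕ`-grading of the `𝒪_S`-algebra `𝒜 = π_* 𝒪_C` whose degree zero part is `𝒪_S`.  The grading is
given on all affine opens of `S`, compatibly with restriction; since elements of `𝒪_S` have degree
zero, the graded pieces are then automatically quasi-coherent `𝒪_S`-modules. -/
structure AffineCone (k : Type u) [Field k] where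
  C : Scheme.{u}
  S : Scheme.{u}
  π : C ⟶ S
  /-- the structure morphism of the base -/
  str : S ⟶ Spec (CommRingCat.of k)
  isAffineHom : IsAffineHom π
  isVariety_base : IsVariety str
  isVariety_total : IsVariety (π ≫ str)
  /-- the graded pieces `𝒜_n(U)` -/
  gr : (U : S.affineOpens) → ℕ → AddSubgroup Γ(C, π ⁻¹ᵁ U.1)
  gradedRing : ∀ U, GradedRing (gr U)
  map_mem_gr : ∀ {U V : S.affineOpens} (h : π ⁻¹ᵁ U.1 ≤ π ⁻¹ᵁ V.1) {n : ℕ}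
    {f : Γ(C, π ⁻¹ᵁ V.1)}, f ∈ gr V n → (C.presheaf.map (homOfLE h).op).hom f ∈ gr U n
  app_injective : ∀ U : S.affineOpens, Function.Injective (π.app U.1).hom
  mem_gr_zero_iff : ∀ (U : S.affineOpens) (f : Γ(C, π ⁻¹ᵁ U.1)),
    f ∈ gr U 0 ↔ ∃ s : Γ(S, U.1), (π.app U.1).hom s = f

/-- An affine cone of varieties `π : C ⟶ S` over `k` with an action of `𝔾_a^r ⋊_w 𝔾_m`, where
`𝔾_m` acts through the grading and `π` is `𝔾_a^r`-invariant.

As `π` is affine and invariant, the action of `𝔾_a^r = Spec k[u_1, …, u_r]` is given by its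
co-action `𝒜 → 𝒜[u_1, …, u_r]`, `f ↦ ((u, x) ↦ f(u.x))`, a morphism of `𝒪_S`-algebras. -/
structure GradedCone (k : Type u) [Field k] (r w : ℕ) extends AffineCone k where
  coact : (U : S.affineOpens) →
    Γ(C, π ⁻¹ᵁ U.1) →+* MvPolynomial (Fin r) Γ(C, π ⁻¹ᵁ U.1)
  coact_map : ∀ {U V : S.affineOpens} (h : π ⁻¹ᵁ U.1 ≤ π ⁻¹ᵁ V.1) (f : Γ(C, π ⁻¹ᵁ V.1)),
    coact U ((C.presheaf.map (homOfLE h).op).hom f) =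
      MvPolynomial.map (C.presheaf.map (homOfLE h).op).hom (coact V f)
  /-- `π` is invariant: the co-action is `𝒪_S`-linear -/
  coact_base : ∀ (U : S.affineOpens) (s : Γ(S, U.1)),
    coact U ((π.app U.1).hom s) = MvPolynomial.C ((π.app U.1).hom s)
  /-- `0.x = x` -/
  coact_zero : ∀ (U : S.affineOpens) (f : Γ(C, π ⁻¹ᵁ U.1)),
    MvPolynomial.constantCoeff (coact U f) = f
  /-- `u.(v.x) = (u + v).x` -/
  coact_add : ∀ (U : S.affineOpens) (f : Γ(C, π ⁻¹ᵁ U.1)),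
    MvPolynomial.map (coact U) (coact U f) =
      MvPolynomial.eval₂ (MvPolynomial.C.comp MvPolynomial.C)
        (fun i => MvPolynomial.X i + MvPolynomial.C (MvPolynomial.X i)) (coact U f)
  /-- `t.(u.x) = (t^w u).(t.x)` for `t` in `𝔾_m`: the coefficient of a monomial of degree `m` in
  the co-action of a function of degree `n` has degree `n - w m` (and is `0` if `n < w m`) -/
  coact_weight : ∀ (U : S.affineOpens) (n : ℕ) (f : Γ(C, π ⁻¹ᵁ U.1)), f ∈ gr U n →
    ∀ m : Fin r →₀ ℕ, MvPolynomial.coeff m (coact U f) = 0 ∨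
      ∃ j : ℕ, j + w * m.degree = n ∧ MvPolynomial.coeff m (coact U f) ∈ gr U j

/-- The `d`-th Fitting ideal of the cokernel of `φ : N → R^n`, generated by the minors of size
`n - d` of `φ` (it is `R` for `d ≥ n` and `0` for `d < 0`). -/
def fittingIdealCoker {R : Type*} [CommRing R] {N : Type*} [AddCommGroup N] [Module R N]
    {n : ℕ} (φ : N →ₗ[R] (Fin n → R)) (d : ℤ) : Ideal R :=
  Ideal.span {x | ∃ (ω : Fin ((n : ℤ) - d).toNat → N) (c : Fin ((n : ℤ) - d).toNat → Fin n),
    x = (Matrix.of fun i j => φ (ω i) (c j)).det}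

namespace GradedCone

variable {k : Type u} [Field k] {r w : ℕ} (X : GradedCone k r w)

/-- The algebra `𝒜(U)` of functions on `C` over an affine open `U` of `S`. -/
abbrev A (U : X.S.affineOpens) : Type u := Γ(X.C, X.π ⁻¹ᵁ U.1)

instance algebraBase (U : X.S.affineOpens) : Algebra Γ(X.S, U.1) (X.A U) :=
  (X.π.app U.1).hom.toAlgebra

/-- The derivation `f ↦ (ξ_1.f, …, ξ_r.f)` of `𝒜(U)` over `𝒜_0(U)`, where `ξ_i.f` is the
coefficient of `u_i` in the co-action of `f`; these `ξ_i` give the infinitesimal action of the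
standard basis of `𝔲 = Lie(𝔾_a^r) = k^r`. -/
def xi (U : X.S.affineOpens) : Derivation Γ(X.S, U.1) (X.A U) (Fin r → X.A U) :=
  Derivation.mk'
    { toFun := fun f i => MvPolynomial.coeff (Finsupp.single i 1) (X.coact U f)
      map_add' := fun f g => by ext i; simp
      map_smul' := fun s f => by
        ext i
        simp [Algebra.smul_def, RingHom.algebraMap_toAlgebra, X.coact_base] }
    (fun f g => by
      ext i
      have hc := X.coact_zero U
      simp only [MvPolynomial.constantCoeff_eq] at hc
      simp only [LinearMap.coe_mk, AddHom.coe_mk, map_mul, MvPolynomial.coeff_mul,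
        Pi.add_apply, Pi.smul_apply, smul_eq_mul]
      rw [Finsupp.antidiagonal_single, Finset.sum_map, Finset.Nat.antidiagonal_succ]
      simp [hc]
      ring)

/-- The morphism `Ω_{𝒜/𝒜_0} → 𝔲^* ⊗ 𝒜 = 𝒜^r`, `df ↦ ∑ u_i ⊗ ξ_i.f`, whose cokernel is
`𝒬(π)`. -/
def conormalMap (U : X.S.affineOpens) :
    Ω[X.A U⁄Γ(X.S, U.1)] →ₗ[X.A U] (Fin r → X.A U) :=
  (X.xi U).liftKaehlerDifferential

/-- The Fitting ideal `Fit_d(𝒬(π))` over the affine open `U`. -/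
def Fit (U : X.S.affineOpens) (d : ℤ) : Ideal (X.A U) :=
  fittingIdealCoker (X.conormalMap U) d

/-- The constants `k → 𝒜(U)`. -/
def const (U : X.S.affineOpens) : k →+* X.A U :=
  ((Scheme.ΓSpecIso (CommRingCat.of k)).inv ≫
    (X.π ≫ X.str).appLE ⊤ (X.π ⁻¹ᵁ U.1) (by simp)).hom

/-- The Lie algebra stabiliser `Stab_𝔲(x)` of a (closed) point `x` of `C`: those `∑ c_i ξ_i` in
`𝔲 = k^r` whose vector field vanishes at `x`. -/
def stab (x : X.C) : Submodule k (Fin r → k) where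
  carrier := {c | ∀ (U : X.S.affineOpens) (hx : x ∈ X.π ⁻¹ᵁ U.1) (f : X.A U),
    (X.C.evaluation _ x hx).hom (∑ i, X.const U (c i) * X.xi U f i) = 0}
  zero_mem' := fun U hx f => by simp
  add_mem' := fun {a b} ha hb U hx f => by
    have h1 := ha U hx f
    have h2 := hb U hx f
    simp only [Pi.add_apply, map_add, add_mul, Finset.sum_add_distrib] at *
    rw [h1, h2, add_zero]
  smul_mem' := fun c a ha U hx f => by
    have h1 := ha U hx f
    simp only [Pi.smul_apply, smul_eq_mul, map_mul, mul_assoc, ← Finset.mul_sum]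
    rw [h1, mul_zero]

/-- The ideal `𝒜_{>0}` over `U`; it cuts out the zero section `Z` of the cone. -/
def positiveIdeal (U : X.S.affineOpens) : Ideal (X.A U) :=
  Ideal.span {f | ∃ n : ℕ, 0 < n ∧ f ∈ X.gr U n}

/-- The underlying set of the zero section `Z ⊆ C`. -/
def zeroSection : Set X.C :=
  {x | ∀ (U : X.S.affineOpens) (hx : x ∈ X.π ⁻¹ᵁ U.1), ∀ f ∈ X.positiveIdeal U,
    (X.C.evaluation _ x hx).hom f = 0}

/-- `d(π)`: the minimum of `dim Stab_𝔲(z)` over the closed points `z` of `Z`. -/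
def d : ℕ :=
  sInf {m | ∃ z ∈ X.zeroSection, IsClosed {z} ∧ m = Module.finrank k (X.stab z)}

/-- `e(π)`: the minimal `n` with `Fit_{d(π)-1}(𝒬(π)) ∩ 𝒜_n ≠ 0`, and `∞` if there is none, that
is, if `Fit_{d(π)-1}(𝒬(π)) = 0`. -/
def e : ℕ∞ :=
  sInf {N | ∃ n : ℕ, N = n ∧
    ∃ (U : X.S.affineOpens), ∃ f ∈ X.Fit U ((X.d : ℤ) - 1), f ∈ X.gr U n ∧ f ≠ 0}

/-- The index `(d(π), e(π))`, in the lexicographic order. -/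
def index : ℕ ×ₗ ℕ∞ := toLex (X.d, X.e)

/-- The ideal `ℐ = Fit_{d(π)}(𝒬(π)) + 𝒜_{>0}` of `Z ∖ Z^reg`, the closed subscheme of `Z` where
`dim Stab_𝔲` exceeds `d(π)`. -/
def nonRegIdeal (U : X.S.affineOpens) : Ideal (X.A U) :=
  X.Fit U X.d ⊔ X.positiveIdeal U

/-- The ideal `𝒥 = ker (𝒜 → 𝒪(𝔾_a^r) ⊗ 𝒜/ℐ)` of the scheme-theoretic image of
`𝔾_a^r × (Z ∖ Z^reg) → C`, that is, of the closure of `𝔾_a^r.(Z ∖ Z^reg)`. -/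
def centreI (U : X.S.affineOpens) : Ideal (X.A U) :=
  RingHom.ker ((MvPolynomial.map (Ideal.Quotient.mk (X.nonRegIdeal U))).comp (X.coact U))

/-- For `T`-points `x`, `x'` of `C` and an invertible function `t` on `T`: `x' = t.x` for the
`𝔾_m`-action on `C` given by the grading, i.e. `f(x') = t^n f(x)` for local sections `f` of
degree `n`. -/
def IsScaled {T : Scheme.{u}} (t : Γ(T, ⊤)ˣ) (x x' : T ⟶ X.C) : Prop :=
  x' ≫ X.π = x ≫ X.π ∧
  ∀ (U : X.S.affineOpens) (V : T.Opens) (h : V ≤ x ⁻¹ᵁ X.π ⁻¹ᵁ U.1)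
    (h' : V ≤ x' ⁻¹ᵁ X.π ⁻¹ᵁ U.1) (n : ℕ), ∀ f ∈ X.gr U n,
    (x'.appLE _ V h').hom f =
      (T.presheaf.map (homOfLE le_top).op).hom (t : Γ(T, ⊤)) ^ n * (x.appLE _ V h).hom f

variable (J : (U : X.S.affineOpens) → Ideal (X.A U))

/-- The inverse image under `f : T ⟶ C` of the ideal sheaf `J` is invertible: locally on `T` it is
generated by one nonzerodivisor. -/
def PullbackInvertible {T : Scheme.{u}} (f : T ⟶ X.C) : Prop :=
  ∀ t : T, ∃ (V : T.affineOpens) (U : X.S.affineOpens) (h : V.1 ≤ f ⁻¹ᵁ X.π ⁻¹ᵁ U.1)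
    (g : Γ(T, V.1)), t ∈ V.1 ∧ g ∈ nonZeroDivisors Γ(T, V.1) ∧
      (J U).map (f.appLE _ V.1 h).hom = Ideal.span {g}

/-- `b : B ⟶ C` is the blow-up of `C` along `J`: the universal morphism to `C` under which the
inverse image of `J` is invertible. -/
structure IsBlowup {B : Scheme.{u}} (b : B ⟶ X.C) : Prop where
  invertible : X.PullbackInvertible J b
  existsUnique_lift : ∀ {T : Scheme.{u}} (f : T ⟶ X.C), X.PullbackInvertible J f →
    ∃! g : T ⟶ B, g ≫ b = f

end GradedCone

/-- An action of `𝔾_m` on a scheme, through its functor of points. -/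
structure GmAction (B : Scheme.{u}) where
  smul : {T : Scheme.{u}} → Γ(T, ⊤)ˣ → (T ⟶ B) → (T ⟶ B)
  naturality : ∀ {T T' : Scheme.{u}} (f : T' ⟶ T) (t : Γ(T, ⊤)ˣ) (x : T ⟶ B),
    f ≫ smul t x = smul (Units.map f.appTop.hom.toMonoidHom t) (f ≫ x)
  one_smul : ∀ {T : Scheme.{u}} (x : T ⟶ B), smul 1 x = x
  mul_smul : ∀ {T : Scheme.{u}} (s t : Γ(T, ⊤)ˣ) (x : T ⟶ B),
    smul (s * t) x = smul s (smul t x)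

namespace GmAction

variable {k : Type u} [Field k] {B : Scheme.{u}} (γ : GmAction B)

open scoped LaurentPolynomial in
/-- The coordinate function `t` on `𝔾_m = Spec k[t, t⁻¹]`. -/
def coordinate (k : Type u) [Field k] : Γ(Spec (CommRingCat.of k[T;T⁻¹]), ⊤)ˣ :=
  Units.map (Scheme.ΓSpecIso (CommRingCat.of k[T;T⁻¹])).inv.hom.toMonoidHom
    (LaurentPolynomial.isUnit_T (R := k) 1).unit

open scoped LaurentPolynomial in
/-- The constant map `𝔾_m → B` at a `k`-point `x`. -/
def constOrbit (x : Spec (CommRingCat.of k) ⟶ B) : Spec (CommRingCat.of k[T;T⁻¹]) ⟶ B :=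
  Spec.map (CommRingCat.ofHom (algebraMap k k[T;T⁻¹])) ≫ x

open scoped LaurentPolynomial in
/-- The orbit map `𝔾_m → B`, `t ↦ t.x` of a `k`-point `x`. -/
def orbit (x : Spec (CommRingCat.of k) ⟶ B) : Spec (CommRingCat.of k[T;T⁻¹]) ⟶ B :=
  γ.smul (coordinate k) (constOrbit x)

/-- `y` is the limit of `t.x` for `t → 0`: the orbit map of `x` extends to a morphism `𝔸¹ → B`
with value `y` at `0`. -/
def IsLimitPoint (x y : Spec (CommRingCat.of k) ⟶ B) : Prop :=
  ∃ h : Spec (CommRingCat.of (Polynomial k)) ⟶ B,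
    Spec.map (CommRingCat.ofHom (Polynomial.toLaurent (R := k))) ≫ h = γ.orbit x ∧
    Spec.map (CommRingCat.ofHom (Polynomial.constantCoeff (R := k))) ≫ h = y

/-- The set of `𝔾_m`-fixed `k`-points of a `k`-scheme `B`. -/
def fixedPoints (str : B ⟶ Spec (CommRingCat.of k)) : Set B :=
  {z | ∃ y : Spec (CommRingCat.of k) ⟶ B, y ≫ str = 𝟙 _ ∧ γ.orbit y = constOrbit y ∧
    z ∈ Set.range y}

/-- `W` is an open stratum of the Białynicki-Birula stratification of `B`: a non-empty open whose
`k`-points are those with limit for `t → 0` in a given connected component of the fixed locus.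
(If `B` is irreducible, there is at most one.) -/
def IsOpenStratum (str : B ⟶ Spec (CommRingCat.of k)) (W : B.Opens) : Prop :=
  (W : Set B).Nonempty ∧ ∃ z₀ ∈ γ.fixedPoints str,
    ∀ x : Spec (CommRingCat.of k) ⟶ B, x ≫ str = 𝟙 _ →
      (Set.range x ⊆ W ↔ ∃ y : Spec (CommRingCat.of k) ⟶ B, γ.IsLimitPoint x y ∧
        Set.range y ⊆ connectedComponentIn (γ.fixedPoints str) z₀)

end GmAction

/-- The cone `X' = (π' : C' ⟶ S')` is the modification of `X = (π : C ⟶ S)` along the invariant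
closed subscheme of `C` with ideal sheaf `J`: `C'` is the open Białynicki-Birula stratum of the
blow-up `B` of `C` along `J` for the induced `𝔾_m`-action, and the maps `p : C' ⟶ C`, `q : S' ⟶ S`
are compatible with all structures. -/
structure Modification {k : Type u} [Field k] {r w : ℕ} (X X' : GradedCone k r w)
    (J : (U : X.S.affineOpens) → Ideal (X.A U)) where
  B : Scheme.{u}
  b : B ⟶ X.C
  isBlowup : X.IsBlowup J b
  action : GmAction B
  /-- `b` is `𝔾_m`-equivariant -/
  isScaled : ∀ {T : Scheme.{u}} (t : Γ(T, ⊤)ˣ) (x : T ⟶ B),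
    X.IsScaled t (x ≫ b) (action.smul t x ≫ b)
  j : X'.C ⟶ B
  isOpenImmersion : IsOpenImmersion j
  isOpenStratum : action.IsOpenStratum (b ≫ X.π ≫ X.str) j.opensRange
  q : X'.S ⟶ X.S
  q_str : q ≫ X.str = X'.str
  comm : (j ≫ b) ≫ X.π = X'.π ≫ q
  /-- `p = j ≫ b` is `𝔾_m`-equivariant -/
  map_mem_gr : ∀ (U : X.S.affineOpens) (U' : X'.S.affineOpens)
    (h : X'.π ⁻¹ᵁ U'.1 ≤ (j ≫ b) ⁻¹ᵁ X.π ⁻¹ᵁ U.1) (n : ℕ), ∀ f ∈ X.gr U n,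
    ((j ≫ b).appLE _ _ h).hom f ∈ X'.gr U' n
  /-- `p = j ≫ b` is `𝔾_a^r`-equivariant -/
  coact_map : ∀ (U : X.S.affineOpens) (U' : X'.S.affineOpens)
    (h : X'.π ⁻¹ᵁ U'.1 ≤ (j ≫ b) ⁻¹ᵁ X.π ⁻¹ᵁ U.1) (f : X.A U),
    X'.coact U' (((j ≫ b).appLE _ _ h).hom f) =
      MvPolynomial.map ((j ≫ b).appLE _ _ h).hom (X.coact U f)

end GradedAdditive

end

/-! The index is a generic invariant of the cone over its base, and the modification changes nothing
over a dense part of the base.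

Over an affine open of `S`, `Fit_m(𝒬)` is generated by the minors of size `r - m` of the matrix of
all `ξ_i.f`. Evaluating such minors at closed points of the zero section shows that `d(π) ≤ m` iff
`Fit_m` has a nonzero element of degree `0` (`d_le_iff`); the degree-`w` homogeneity of `ξ` makes
degree `0` suffice. Hence `d` and `e` are both read off from the predicate `HasFit U m n`, and this
does not depend on the nonempty affine open `U` (`hasFit_iff`).

A nonzero element of `Fit_{d(π)}` of degree `0` is a function `s` on the base. Where `s` is
invertible, `Fit_{d(π)}`, `ℐ` and `𝒥` are all the unit ideal (`exists_centreI_eq_top`), so the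
blow-up is an isomorphism there. The stratum `C'` is a nonempty open of the blow-up, so over some
affine open of `S'` the map `p` is an open immersion into this part of `C`.

Such an open immersion need not identify the two cones, as its image need not be a full preimage
from the base. It does so after inverting one function of degree `0`
(`exists_pow_proj_zero_mul_eq`), and the `ξ_i` are linear over degree `0`, so `HasFit` is unchanged
(`hasFit_iff_of_isOpenImmersion`). -/

namespace GradedAdditive

/-! ### Minors, rank and solution spaces over a field. -/

section LinearAlgebra

variable {K ι : Type*} [Field K] {r : ℕ}

theorem exists_linearIndependent_fin {V : Type*} [AddCommGroup V] [Module K V]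
    [Module.Finite K V] (w : ι → V) {N : ℕ}
    (h : N ≤ Module.finrank K (Submodule.span K (Set.range w))) :
    ∃ g : Fin N → ι, LinearIndependent K (w ∘ g) := by
  obtain ⟨κ', a, -, hs, hl⟩ := exists_linearIndependent' K w
  have : Finite κ' := hl.finite
  have := Fintype.ofFinite κ'
  rw [← hs, finrank_span_eq_card hl] at h
  obtain ⟨f⟩ := Function.Embedding.nonempty_of_card_le (α := Fin N) (β := κ') (by simpa using h)
  exact ⟨a ∘ f, hl.comp f f.injective⟩

/-- A family of vectors spans a space of dimension at least `N` iff it has a nonzero minor of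
size `N`. -/
theorem exists_minor_ne_zero_iff (v : ι → Fin r → K) (N : ℕ) :
    (∃ (g : Fin N → ι) (c : Fin N → Fin r), (Matrix.of fun i j => v (g i) (c j)).det ≠ 0) ↔
      N ≤ Module.finrank K (Submodule.span K (Set.range v)) := by
  constructor
  · rintro ⟨g, c, h⟩
    have hl : LinearIndependent K ((LinearMap.funLeft K K c) ∘ (v ∘ g)) :=
      Matrix.linearIndependent_rows_of_det_ne_zero h
    have hl' : LinearIndependent K (v ∘ g) := hl.of_comp
    have := finrank_span_eq_card hl'
    rw [Fintype.card_fin] at this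
    rw [← this]
    exact Submodule.finrank_mono (Submodule.span_mono (Set.range_comp_subset_range g v))
  · intro h
    obtain ⟨g, hg⟩ := exists_linearIndependent_fin v h
    let M : Matrix (Fin N) (Fin r) K := Matrix.of (v ∘ g)
    -- Row rank equals column rank: the `N` independent rows found so far leave room for `N`
    -- independent columns.
    have hM : M.rank = N := by
      simpa using LinearIndependent.rank_matrix (M := M) hg
    rw [Matrix.rank_eq_finrank_span_cols] at hM
    obtain ⟨c, hc⟩ := exists_linearIndependent_fin M.col hM.ge
    refine ⟨g, c, ?_⟩
    have := (Matrix.linearIndependent_cols_iff_isUnit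
      (A := Matrix.of fun i j => v (g i) (c j))).1 hc
    exact ((Matrix.isUnit_iff_isUnit_det _).1 this).ne_zero

/-- The dimension of the space of solutions of a system of linear equations. -/
theorem finrank_add_finrank_span_eq (v : ι → Fin r → K) (S : Submodule K (Fin r → K))
    (hS : ∀ c, c ∈ S ↔ ∀ f, ∑ i, c i * v f i = 0) :
    Module.finrank K (Submodule.span K (Set.range v)) + Module.finrank K S = r := by
  -- The dot product turns the span of the equations into a space of functionals whose common kernel
  -- is `S`.
  have : S = ((Submodule.span K (Set.range v)).map
      (dotProductEquiv K (Fin r)).toLinearMap).dualCoannihilator := by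
    ext c
    rw [hS, Submodule.mem_dualCoannihilator]
    constructor
    · rintro h _ ⟨x, hx, rfl⟩
      induction hx using Submodule.span_induction with
      | mem x hx =>
        obtain ⟨f, rfl⟩ := hx
        simpa [dotProduct, mul_comm] using h f
      | zero => simp
      | add x y _ _ hx hy => simpa using congr($hx + $hy)
      | smul a x _ hx => simp at hx; simp [hx]
    · intro h f
      simpa [dotProduct, mul_comm] using h _ ⟨v f, Submodule.subset_span ⟨f, rfl⟩, rfl⟩
  have h2 := Subspace.finrank_add_finrank_dualCoannihilator_eq
    ((Submodule.span K (Set.range v)).map (dotProductEquiv K (Fin r)).toLinearMap)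
  rw [← this, LinearEquiv.finrank_map_eq] at h2
  simpa using h2

end LinearAlgebra

/-! ### Fitting ideals as ideals of minors. -/

/-- A multilinear map sending all families in a generating set `S` to `I` has values in `I`. -/
theorem multilinearMap_mem_of_span_eq_top {R N ι : Type*} [CommRing R] [AddCommGroup N]
    [Module R N] [Fintype ι] [DecidableEq ι] (F : MultilinearMap R (fun _ : ι => N) R)
    {S : Set N} (hS : Submodule.span R S = ⊤) (I : Ideal R) (h : ∀ ω, (∀ i, ω i ∈ S) → F ω ∈ I)
    (ω : ι → N) : F ω ∈ I := by
  -- Induction on the set `s` of slots in which an arbitrary vector is allowed.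
  suffices H : ∀ (s : Finset ι) (ω : ι → N), (∀ i ∉ s, ω i ∈ S) → F ω ∈ I from
    H Finset.univ ω (by simp)
  intro s
  induction s using Finset.induction_on with
  | empty => exact fun ω hω => h ω fun i => hω i (by simp)
  | insert a s ha ih =>
    intro ω hω
    have key : ∀ x : N, F (Function.update ω a x) ∈ I := by
      intro x
      have hx : x ∈ Submodule.span R S := hS ▸ Submodule.mem_top
      induction hx using Submodule.span_induction with
      | mem x hx =>
        refine ih _ fun i hi => ?_
        by_cases hia : i = a
        · subst hia; simpa
        · rw [Function.update_of_ne hia]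
          exact hω i (by simp [hia, hi])
      | zero => simp
      | add x y _ _ hx hy => rw [F.map_update_add]; exact I.add_mem hx hy
      | smul c x _ hx => rw [F.map_update_smul]; exact I.mul_mem_left _ hx
    simpa using key (ω a)

/-- The ideal generated by the minors of size `r - d` of the matrix with rows `ξ a`. -/
def minorIdeal {R M : Type*} [CommRing R] {r : ℕ} (ξ : M → Fin r → R) (d : ℤ) : Ideal R :=
  Ideal.span {x | ∃ (g : Fin ((r : ℤ) - d).toNat → M) (c : Fin ((r : ℤ) - d).toNat → Fin r),
    x = (Matrix.of fun i j => ξ (g i) (c j)).det}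

/-- A minor with fixed columns is multilinear in its rows, so rows from a generating family of `N`
suffice. -/
theorem fittingIdealCoker_eq_minorIdeal {R N M : Type*} [CommRing R] [AddCommGroup N] [Module R N]
    {r : ℕ} (φ : N →ₗ[R] (Fin r → R)) (D : M → N) (hD : Submodule.span R (Set.range D) = ⊤)
    (d : ℤ) : fittingIdealCoker φ d = minorIdeal (φ ∘ D) d := by
  apply le_antisymm
  · refine Ideal.span_le.2 ?_
    rintro _ ⟨ω, c, rfl⟩
    let F : MultilinearMap R (fun _ : Fin ((r : ℤ) - d).toNat => N) R :=
      (Matrix.detRowAlternating (R := R) (n := Fin ((r : ℤ) - d).toNat)).toMultilinearMap.compLinearMap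
        (fun _ => (LinearMap.funLeft R R c).comp φ)
    refine multilinearMap_mem_of_span_eq_top F hD _ (fun ω hω => ?_) ω
    choose g hg using hω
    obtain rfl : ω = D ∘ g := funext fun i => (hg i).symm
    exact Ideal.subset_span ⟨g, c, rfl⟩
  · refine Ideal.span_mono ?_
    rintro _ ⟨g, c, rfl⟩
    exact ⟨D ∘ g, c, rfl⟩

/-- The minor of size `0` is `1`. -/
theorem minorIdeal_self {R M : Type*} [CommRing R] {r : ℕ} (ξ : M → Fin r → R) :
    minorIdeal ξ r = ⊤ := by
  rw [Ideal.eq_top_iff_one]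
  have h : IsEmpty (Fin ((r : ℤ) - r).toNat) := by simpa using Fin.isEmpty
  exact Ideal.subset_span ⟨h.elim, h.elim, (Matrix.det_isEmpty).symm⟩

theorem map_mem_minorIdeal {A A' : Type*} [CommRing A] [CommRing A'] {r : ℕ} (φ : A →+* A')
    (ξ : A → Fin r → A) (ξ' : A' → Fin r → A') (hξ : ∀ a i, ξ' (φ a) i = φ (ξ a i)) {d : ℤ} {f : A}
    (hf : f ∈ minorIdeal ξ d) : φ f ∈ minorIdeal ξ' d := by
  suffices minorIdeal ξ d ≤ (minorIdeal ξ' d).comap φ from this hf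
  refine Ideal.span_le.2 ?_
  rintro _ ⟨g, c, rfl⟩
  refine Ideal.subset_span ⟨φ ∘ g, c, ?_⟩
  rw [RingHom.map_det]
  congr 1
  ext i j
  simp [hξ]

/-! ### Graded rings: homogeneous components, denominators and minors. -/

section Graded

variable {A A' : Type*} [CommRing A] [CommRing A'] (𝒜 : ℕ → AddSubgroup A)
  (𝒜' : ℕ → AddSubgroup A') [GradedRing 𝒜] [GradedRing 𝒜']

theorem proj_of_mem {n : ℕ} {a : A} (ha : a ∈ 𝒜 n) : GradedRing.proj 𝒜 n a = a := by
  rw [GradedRing.proj_apply, DirectSum.decompose_of_mem_same _ ha]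

theorem proj_mem (n : ℕ) (a : A) : GradedRing.proj 𝒜 n a ∈ 𝒜 n := by
  rw [GradedRing.proj_apply]; exact SetLike.coe_mem _

theorem proj_map {φ : A →+* A'} (hφ : ∀ n, ∀ a ∈ 𝒜 n, φ a ∈ 𝒜' n) (n : ℕ) (a : A) :
    GradedRing.proj 𝒜' n (φ a) = φ (GradedRing.proj 𝒜 n a) := by
  induction a using DirectSum.Decomposition.inductionOn 𝒜 with
  | zero => simp
  | @homogeneous i m =>
    rw [GradedRing.proj_apply, GradedRing.proj_apply]
    by_cases h : i = n
    · subst h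
      rw [DirectSum.decompose_of_mem_same _ (hφ _ _ m.2), DirectSum.decompose_of_mem_same _ m.2]
    · rw [DirectSum.decompose_of_mem_ne _ (hφ _ _ m.2) h, DirectSum.decompose_of_mem_ne _ m.2 h,
        map_zero]
  | add a b ha hb => rw [map_add, map_add, ha, hb, map_add, map_add]

/-- `a` and its component of degree `n` have the same image, so they agree by injectivity. -/
theorem mem_of_map_mem {φ : A →+* A'} (hinj : Function.Injective φ)
    (hφ : ∀ n, ∀ a ∈ 𝒜 n, φ a ∈ 𝒜' n) {n : ℕ} {a : A} (h : φ a ∈ 𝒜' n) : a ∈ 𝒜 n := by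
  have := proj_map 𝒜 𝒜' hφ n a
  rw [proj_of_mem 𝒜' h] at this
  rw [hinj this]
  exact proj_mem 𝒜 n a

/-- The projection to degree zero is multiplicative. -/
theorem proj_zero_eq (a : A) : GradedRing.proj 𝒜 0 a = GradedRing.projZeroRingHom 𝒜 a := rfl

theorem sub_proj_zero_mem (a : A) : a - GradedRing.proj 𝒜 0 a ∈
    Ideal.span {f | ∃ n : ℕ, 0 < n ∧ f ∈ 𝒜 n} := by
  induction a using DirectSum.Decomposition.inductionOn 𝒜 with
  | zero => simp
  | @homogeneous i m =>
    rcases Nat.eq_zero_or_pos i with rfl | hi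
    · rw [proj_of_mem 𝒜 m.2, sub_self]; exact Ideal.zero_mem _
    · rw [GradedRing.proj_apply, DirectSum.decompose_of_mem_ne _ m.2 hi.ne', sub_zero]
      exact Ideal.subset_span ⟨i, hi, m.2⟩
  | add a b ha hb =>
    rw [map_add, add_sub_add_comm]
    exact Ideal.add_mem _ ha hb

theorem proj_zero_of_mem {a : A} (h : a ∈ Ideal.span {f | ∃ n : ℕ, 0 < n ∧ f ∈ 𝒜 n}) :
    GradedRing.proj 𝒜 0 a = 0 := by
  suffices Ideal.span {f | ∃ n : ℕ, 0 < n ∧ f ∈ 𝒜 n} ≤ RingHom.ker (GradedRing.projZeroRingHom 𝒜)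
    from this h
  refine Ideal.span_le.2 ?_
  rintro f ⟨n, hn, hf⟩
  change GradedRing.proj 𝒜 0 f = 0
  rw [GradedRing.proj_apply, DirectSum.decompose_of_mem_ne _ hf hn.ne']

/-- If every element of `A'` is, up to a denominator, in `φ(A)`, then every element is
so up to a denominator of degree zero. -/
theorem exists_pow_proj_zero_mul_eq {φ : A →+* A'} (hφ : ∀ n, ∀ a ∈ 𝒜 n, φ a ∈ 𝒜' n) {c : A}
    (hc : ∀ a', ∃ (N : ℕ) (b : A), φ c ^ N * a' = φ b) (a' : A') :
    ∃ (N : ℕ) (b : A), φ (GradedRing.proj 𝒜 0 c) ^ N * a' = φ b := by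
  induction a' using DirectSum.Decomposition.inductionOn 𝒜' with
  | zero => exact ⟨0, 0, by simp⟩
  | @homogeneous n m =>
    obtain ⟨N, b, h⟩ := hc m
    -- Compare components of degree `n` in `φ c ^ N * m = φ b`. As `m` has degree `n`, only the
    -- degree-zero part of `φ c ^ N` contributes on the left, and taking that part commutes with
    -- powers.
    refine ⟨N, GradedRing.proj 𝒜 n b, ?_⟩
    rw [← proj_map 𝒜 𝒜' hφ n b, ← h, GradedRing.proj_apply 𝒜' n]
    have := DirectSum.coe_decompose_mul_add_of_right_mem 𝒜' (i := 0) (a := φ c ^ N) m.2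
    rw [zero_add] at this
    rw [this, ← GradedRing.proj_apply,
      ← map_pow φ c, proj_map 𝒜 𝒜' hφ 0, proj_zero_eq, proj_zero_eq, map_pow, map_pow]
  | add x y hx hy =>
    obtain ⟨N, b, h⟩ := hx
    obtain ⟨N', b', h'⟩ := hy
    refine ⟨N + N', (GradedRing.proj 𝒜 0 c) ^ N' * b + (GradedRing.proj 𝒜 0 c) ^ N * b', ?_⟩
    rw [map_add, map_mul, map_mul, ← h, ← h', map_pow, map_pow]
    ring

/-- The ideals of minors of two birational graded rings with derivations have nonzero elements in
the same degrees. -/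
theorem exists_mem_minorIdeal_iff [IsDomain A'] {φ : A →+* A'} (hinj : Function.Injective φ)
    (hφ : ∀ n, ∀ a ∈ 𝒜 n, φ a ∈ 𝒜' n) {r : ℕ} {ξ : A → Fin r → A} {ξ' : A' → Fin r → A'}
    (hξ : ∀ a i, ξ' (φ a) i = φ (ξ a i))
    (hmul : ∀ c ∈ 𝒜 0, ∀ a' i, ξ' (φ c * a') i = φ c * ξ' a' i)
    {c : A} (hc0 : GradedRing.proj 𝒜 0 c ≠ 0) (hc : ∀ a', ∃ (N : ℕ) (b : A), φ c ^ N * a' = φ b)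
    (m : ℤ) (n : ℕ) :
    (∃ f ∈ minorIdeal ξ m, f ∈ 𝒜 n ∧ f ≠ 0) ↔ ∃ f ∈ minorIdeal ξ' m, f ∈ 𝒜' n ∧ f ≠ 0 := by
  constructor
  · rintro ⟨f, hf, hfn, hf0⟩
    exact ⟨φ f, map_mem_minorIdeal φ ξ ξ' hξ hf, hφ _ _ hfn, by rwa [ne_eq, map_eq_zero_iff φ hinj]⟩
  rintro ⟨f, hf, hfn, hf0⟩
  have hc' := exists_pow_proj_zero_mul_eq 𝒜 𝒜' hφ hc
  set e := GradedRing.proj 𝒜 0 c with he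
  have hpow : ∀ N, e ^ N ∈ 𝒜 0 := fun N => by
    have := SetLike.pow_mem_graded N (proj_mem 𝒜 0 c)
    rwa [smul_zero] at this
  -- The degree can be forgotten while clearing denominators: multiplication by a power of `e`, of
  -- degree `0`, preserves it, and `mem_of_map_mem` recovers it for `b`.
  suffices H : ∃ (N : ℕ) (b : A), b ∈ minorIdeal ξ m ∧ φ e ^ N * f = φ b by
    obtain ⟨N, b, hb, h⟩ := H
    refine ⟨b, hb, mem_of_map_mem 𝒜 𝒜' hinj hφ (n := n) ?_, ?_⟩
    · rw [← h, ← zero_add n, ← map_pow]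
      exact SetLike.mul_mem_graded (hφ _ _ (hpow N)) hfn
    · rintro rfl
      rw [map_zero] at h
      exact mul_ne_zero (pow_ne_zero _ (by rwa [ne_eq, map_eq_zero_iff φ hinj])) hf0 h
  clear hfn hf0
  induction hf using Submodule.span_induction with
  | mem x hx =>
    obtain ⟨g, cc, rfl⟩ := hx
    choose N b hb using fun i => hc' (g i)
    refine ⟨∑ i, N i, (Matrix.of fun i j => ξ (b i) (cc j)).det, Ideal.subset_span ⟨b, cc, rfl⟩, ?_⟩
    -- Each row is scaled by its own power of `φ e`; these powers pass through `ξ'` because they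
    -- have degree `0`.
    rw [RingHom.map_det, ← Finset.prod_pow_eq_pow_sum, ← Matrix.det_mul_column]
    congr 1
    ext i j
    simp only [Matrix.of_apply, RingHom.mapMatrix_apply, Matrix.map_apply, ← hξ, ← hb]
    rw [← map_pow, hmul _ (hpow _)]
  | zero => exact ⟨0, 0, Ideal.zero_mem _, by simp⟩
  | add x y _ _ hx hy =>
    obtain ⟨N, b, hb, h⟩ := hx
    obtain ⟨N', b', hb', h'⟩ := hy
    refine ⟨N + N', e ^ N' * b + e ^ N * b',
      Ideal.add_mem _ (Ideal.mul_mem_left _ _ hb) (Ideal.mul_mem_left _ _ hb'), ?_⟩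
    rw [map_add, map_mul, map_mul, ← h, ← h', map_pow, map_pow]
    ring
  | smul a x _ hx =>
    obtain ⟨N, b, hb, h⟩ := hx
    obtain ⟨N', b', h'⟩ := hc' a
    refine ⟨N + N', b' * b, Ideal.mul_mem_left _ _ hb, ?_⟩
    rw [map_mul, ← h, ← h', smul_eq_mul]
    ring

/-- If `ξ` lowers degrees by `w`, then a minor which does not vanish at a point of the zero section
can be chosen of degree zero. -/
theorem exists_mem_minorIdeal_zero {r w : ℕ} {ξ : A →+ (Fin r → A)}
    (hξ : ∀ n, ∀ a ∈ 𝒜 n, ∀ i, ξ a i = 0 ∨ ∃ j, j + w = n ∧ ξ a i ∈ 𝒜 j)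
    {K : Type*} [Field K] (ev : A →+* K) (hev : ∀ n, 0 < n → ∀ a ∈ 𝒜 n, ev a = 0) (m : ℤ) :
    (∃ f ∈ minorIdeal ξ m, f ∈ 𝒜 0 ∧ ev f ≠ 0) ↔
      ∃ (g : Fin ((r : ℤ) - m).toNat → A) (c : Fin ((r : ℤ) - m).toNat → Fin r),
        (Matrix.of fun i j => ev (ξ (g i) (c j))).det ≠ 0 := by
  constructor
  · rintro ⟨f, hf, -, hf0⟩
    by_contra! H
    refine hf0 ?_
    suffices minorIdeal ξ m ≤ RingHom.ker ev from this hf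
    refine Ideal.span_le.2 ?_
    rintro _ ⟨g, c, rfl⟩
    rw [SetLike.mem_coe, RingHom.mem_ker, RingHom.map_det]
    exact H g c
  · rintro ⟨g, c, h⟩
    -- Since `ξ` lowers degrees by `w`, only the component of degree `w` contributes to degree `0`.
    have h1 : ∀ a i, GradedRing.proj 𝒜 0 (ξ a i) = ξ (GradedRing.proj 𝒜 w a) i := by
      intro a i
      induction a using DirectSum.Decomposition.inductionOn 𝒜 with
      | zero => simp
      | @homogeneous n a =>
        by_cases hn : n = w
        · subst hn
          rw [proj_of_mem 𝒜 a.2, proj_of_mem 𝒜]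
          obtain h | ⟨j, hj, h⟩ := hξ n a a.2 i
          · rw [h]; exact zero_mem _
          · obtain rfl : j = 0 := by omega
            exact h
        · rw [GradedRing.proj_apply _ w, DirectSum.decompose_of_mem_ne _ a.2 hn]
          obtain h | ⟨j, hj, h⟩ := hξ n a a.2 i
          · simp [h]
          · rw [GradedRing.proj_apply, DirectSum.decompose_of_mem_ne _ h (by omega)]; simp
      | add a b ha hb => simp only [map_add, Pi.add_apply, ha, hb]
    have h2 : ∀ a, ev a = ev (GradedRing.proj 𝒜 0 a) := by
      intro a
      have := sub_proj_zero_mem 𝒜 a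
      rw [← sub_eq_zero, ← map_sub]
      suffices Ideal.span {f | ∃ n : ℕ, 0 < n ∧ f ∈ 𝒜 n} ≤ RingHom.ker ev from this ‹_›
      refine Ideal.span_le.2 ?_
      rintro f ⟨n, hn, hf⟩
      exact hev n hn f hf
    -- Projection to degree `0` is a ring homomorphism, so this minor is the degree-zero part of the
    -- given one; `ev` does not see the difference.
    refine ⟨(Matrix.of fun i j => ξ (GradedRing.proj 𝒜 w (g i)) (c j)).det,
      Ideal.subset_span ⟨_, c, rfl⟩, ?_, ?_⟩
    · have : (Matrix.of fun i j => ξ (GradedRing.proj 𝒜 w (g i)) (c j)) =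
          (GradedRing.projZeroRingHom 𝒜).mapMatrix (Matrix.of fun i j => ξ (g i) (c j)) := by
        ext i j
        exact (h1 _ _).symm
      rw [this, ← RingHom.map_det]
      exact proj_mem 𝒜 0 _
    · rw [RingHom.map_det]
      convert h using 2
      ext i j
      exact (congrArg ev (h1 _ _).symm).trans (h2 _).symm

end Graded

end GradedAdditive

namespace GradedAdditive

/-! ### Open immersions, localisation and closed points. -/

section Scheme

variable {X Y : Scheme.{u}} (p : X ⟶ Y) {U : Y.Opens} {V : X.Opens}

/-- Only the restriction of `p` to `V` is an open immersion, so sections over `D` are compared with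
those over the part of `p ⁻¹ᵁ D` inside `V`. -/
theorem isIso_appLE_of_le_opensRange (V : X.Opens) [IsOpenImmersion (V.ι ≫ p)] {D : Y.Opens}
    (hD : D ≤ (V.ι ≫ p).opensRange) {W : X.Opens} (hW : W = V ⊓ p ⁻¹ᵁ D) :
    IsIso (p.appLE D W (hW.trans_le inf_le_right)) := by
  have hWV : W ≤ V := hW.trans_le inf_le_left
  have e1 : V.ι ⁻¹ᵁ W = (V.ι ≫ p) ⁻¹ᵁ D := by
    rw [hW, Scheme.Hom.comp_preimage]
    ext x
    exact ⟨fun hx => hx.2, fun hx => ⟨x.2, hx⟩⟩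
  have h1 : IsIso ((V.ι ≫ p).appLE D (V.ι ⁻¹ᵁ W) e1.le) := by
    have := (V.ι ≫ p).isIso_app D hD
    rw [Scheme.Hom.appLE]
    have : IsIso (V.toScheme.presheaf.map (homOfLE e1.le).op) := by
      have : homOfLE e1.le = eqToHom e1 := rfl
      rw [this]; infer_instance
    infer_instance
  have h2 : IsIso (V.ι.app W) := V.ι.isIso_app W (by simpa using hWV)
  have h3 : (V.ι ≫ p).appLE D (V.ι ⁻¹ᵁ W) e1.le =
      p.appLE D W (hW.trans_le inf_le_right) ≫ V.ι.app W := by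
    rw [Scheme.Hom.app_eq_appLE, Scheme.Hom.appLE_comp_appLE]
  rw [h3] at h1
  exact IsIso.of_isIso_comp_right _ (V.ι.app W)

variable [IsOpenImmersion (V.ι ≫ p)] (h : V ≤ p ⁻¹ᵁ U)

/-- An open immersion into an affine open `U` of `Y` induces an isomorphism of the localisations at
`c` if its image contains the basic open of `c`. -/
theorem exists_pow_mul_eq_appLE [IsIntegral X] (hU : IsAffineOpen U)
    (c : Γ(Y, U)) (hc : Y.basicOpen c ≤ (V.ι ≫ p).opensRange) (hne : (p.appLE U V h).hom c ≠ 0)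
    (a : Γ(X, V)) :
    ∃ (N : ℕ) (b : Γ(Y, U)), (p.appLE U V h).hom c ^ N * a = (p.appLE U V h).hom b := by
  -- `p` maps `W` isomorphically onto the basic open of `c`, so `a` restricted to `W` is a fraction
  -- `b / c ^ N`. Integrality of `X` carries the resulting identity from `W` back to `V`.
  set W := X.basicOpen ((p.appLE U V h).hom c) with hWdef
  have hW : W = V ⊓ p ⁻¹ᵁ Y.basicOpen c := Scheme.basicOpen_appLE p V U h c
  have hWV : W ≤ V := hW.trans_le inf_le_left
  have hWne : Nonempty W := by
    by_contra hcon
    refine hne ((basicOpen_eq_bot_iff _).1 ?_)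
    ext x
    exact ⟨fun hx => hcon ⟨x, hx⟩, fun hx => hx.elim⟩
  have := isIso_appLE_of_le_opensRange p V hc hW
  have hbij := (ConcreteCategory.isIso_iff_bijective _).1 this
  obtain ⟨b', hb'⟩ := hbij.2 ((X.presheaf.map (homOfLE hWV).op).hom a)
  have := hU.isLocalization_basicOpen c
  obtain ⟨N, b, hb⟩ := IsLocalization.Away.surj c b'
  refine ⟨N, b, ?_⟩
  apply map_injective_of_isIntegral X (homOfLE hWV)
  have hcomm : ∀ x : Γ(Y, U), X.presheaf.map (homOfLE hWV).op ((p.appLE U V h).hom x) =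
      p.appLE (Y.basicOpen c) W (hW.trans_le inf_le_right) (algebraMap _ Γ(Y, Y.basicOpen c) x) := by
    have e : p.appLE U V h ≫ X.presheaf.map (homOfLE hWV).op =
        Y.presheaf.map (homOfLE (Y.basicOpen_le c)).op ≫
          p.appLE (Y.basicOpen c) W (hW.trans_le inf_le_right) := by
      rw [Scheme.Hom.map_appLE, Scheme.Hom.appLE_map]
    exact fun x => congr($(e).hom x)
  rw [hcomm, ← hb, map_mul, map_mul, map_pow, map_pow, hb', hcomm, mul_comm]

/-- The map is restriction to the image of `V`, injective as `Y` is integral, followed by an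
isomorphism. -/
theorem appLE_injective_of_isOpenImmersion [IsIntegral Y] [Nonempty V] :
    Function.Injective (p.appLE U V h).hom := by
  set D := (V.ι ≫ p).opensRange
  have hDU : D ≤ U := by
    rintro _ ⟨x, rfl⟩
    exact h x.2
  have hW : V = V ⊓ p ⁻¹ᵁ D := by
    refine le_antisymm (le_inf le_rfl ?_) inf_le_left
    intro x hx
    exact ⟨⟨x, hx⟩, rfl⟩
  have : Nonempty D := ⟨⟨_, ⟨Classical.arbitrary V, rfl⟩⟩⟩
  have h1 := isIso_appLE_of_le_opensRange p V le_rfl hW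
  have hbij := (ConcreteCategory.isIso_iff_bijective _).1 h1
  rw [← Scheme.Hom.map_appLE p (hW.trans_le inf_le_right) (homOfLE hDU).op]
  exact hbij.1.comp (map_injective_of_isIntegral Y (homOfLE hDU))

/-- Points in the zero locus of an ideal where a function outside its radical does not vanish. -/
theorem exists_mem_basicOpen_of_notMem_radical {X : Scheme.{u}} {V : X.Opens} (hV : IsAffineOpen V)
    (I : Ideal Γ(X, V)) {f : Γ(X, V)} (hf : f ∉ I.radical) :
    ∃ z ∈ X.basicOpen f, ∀ g ∈ I, z ∉ X.basicOpen g := by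
  rw [Ideal.radical_eq_sInf, Submodule.mem_sInf] at hf
  push Not at hf
  obtain ⟨P, ⟨hIP, hP⟩, hfP⟩ := hf
  have key : ∀ g, hV.fromSpec ⟨P, hP⟩ ∈ X.basicOpen g ↔ g ∉ P := fun g => by
    change _ ∈ hV.fromSpec ⁻¹ᵁ X.basicOpen g ↔ _
    rw [hV.fromSpec_preimage_basicOpen]
    rfl
  exact ⟨hV.fromSpec ⟨P, hP⟩, (key f).2 hfP, fun g hg hz => (key g).1 hz (hIP hg)⟩

/-- Evaluation of constants at a closed point. -/
theorem const_evaluation {k : Type u} [Field k] [IsAlgClosed k] {X : Scheme.{u}}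
    (f : X ⟶ Spec (CommRingCat.of k)) [LocallyOfFiniteType f] (V : X.Opens) (x : X) (hx : x ∈ V)
    (hV : V ≤ f ⁻¹ᵁ ⊤) (hc : IsClosed {x}) :
    (Scheme.ΓSpecIso (CommRingCat.of k)).inv ≫ f.appLE ⊤ V hV ≫ X.evaluation V x hx =
      (residueFieldIsoBase f x hc).inv := by
  have h1 : (X.fromSpecStalk x).appTop =
      X.presheaf.germ ⊤ x trivial ≫ (Scheme.ΓSpecIso (X.presheaf.stalk x)).inv := by
    rw [Scheme.fromSpecStalk_appTop]
    have : (homOfLE le_top : (⊤ : (Spec (X.presheaf.stalk x)).Opens) ⟶ ⊤) = 𝟙 _ := rfl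
    rw [this, op_id, CategoryTheory.Functor.map_id, Category.comp_id]
  have h2 : f.appLE ⊤ V hV ≫ X.evaluation V x hx =
      f.appTop ≫ X.presheaf.germ ⊤ x trivial ≫ X.residue x := by
    rw [Scheme.Hom.appLE, Category.assoc, ← Scheme.germ_residue, X.presheaf.germ_res_assoc]
    rfl
  rw [← cancel_mono (Scheme.ΓSpecIso (X.residueField x)).inv,
    Scheme.ΓSpecIso_inv_naturality (residueFieldIsoBase f x hc).inv,
    SpecMap_residueFieldIsoBase_inv, h2, Scheme.Hom.comp_appTop, Scheme.fromSpecResidueField,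
    Scheme.Hom.comp_appTop, h1]
  simp only [Category.assoc]
  rw [Scheme.ΓSpecIso_inv_naturality]


end Scheme

end GradedAdditive

namespace GradedAdditive

namespace GradedCone

/-! ### Basic properties of a graded cone. -/

section

variable {k : Type u} [Field k] {r w : ℕ} (X : GradedCone k r w)

instance : AlgebraicGeometry.IsIntegral X.C := X.isVariety_total.isIntegral

instance : AlgebraicGeometry.IsIntegral X.S := X.isVariety_base.isIntegral

instance : IsAffineHom X.π := X.isAffineHom

instance : LocallyOfFiniteType (X.π ≫ X.str) := X.isVariety_total.locallyOfFiniteType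

noncomputable instance (U : X.S.affineOpens) : GradedRing (X.gr U) := X.gradedRing U

instance : JacobsonSpace X.C :=
  LocallyOfFiniteType.jacobsonSpace (X.π ≫ X.str)

theorem isAffineOpen_preimage (U : X.S.affineOpens) : IsAffineOpen (X.π ⁻¹ᵁ U.1) :=
  U.2.preimage X.π

theorem nonempty_preimage_of_ne_zero (U : X.S.affineOpens) {f : X.A U} (hf : f ≠ 0) :
    Nonempty (X.π ⁻¹ᵁ U.1) := by
  by_contra hcon
  refine hf ((basicOpen_eq_bot_iff f).1 ?_)
  ext x
  exact ⟨fun hx => hcon ⟨x, X.C.basicOpen_le f hx⟩, fun hx => hx.elim⟩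

theorem nonempty_preimage (U : X.S.affineOpens) [hU : Nonempty U.1] : Nonempty (X.π ⁻¹ᵁ U.1) :=
  X.nonempty_preimage_of_ne_zero U
    ((map_ne_zero_iff (X.π.app U.1).hom (X.app_injective U)).2 one_ne_zero)

theorem xi_apply (U : X.S.affineOpens) (f : X.A U) (i : Fin r) :
    X.xi U f i = MvPolynomial.coeff (Finsupp.single i 1) (X.coact U f) := rfl

/-- The differentials `df` generate `Ω`, so rows `ξ f` give all minors and Kähler differentials
disappear from the argument. -/
theorem Fit_eq_minorIdeal (U : X.S.affineOpens) (d : ℤ) : X.Fit U d = minorIdeal (X.xi U) d := by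
  rw [Fit, fittingIdealCoker_eq_minorIdeal _ _
    (KaehlerDifferential.span_range_derivation Γ(X.S, U.1) (X.A U))]
  congr 1
  ext1 f
  exact Derivation.liftKaehlerDifferential_comp_D _ f

theorem xi_degree (U : X.S.affineOpens) (n : ℕ) (a : X.A U) (ha : a ∈ X.gr U n) (i : Fin r) :
    X.xi U a i = 0 ∨ ∃ j, j + w = n ∧ X.xi U a i ∈ X.gr U j := by
  simpa [xi_apply] using X.coact_weight U n a ha (Finsupp.single i 1)

theorem xi_mul_of_mem_gr_zero (U : X.S.affineOpens) {c : X.A U} (hc : c ∈ X.gr U 0) (a : X.A U)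
    (i : Fin r) : X.xi U (c * a) i = c * X.xi U a i := by
  obtain ⟨s, rfl⟩ := (X.mem_gr_zero_iff U c).1 hc
  have : (X.π.app U.1).hom s = algebraMap Γ(X.S, U.1) (X.A U) s := rfl
  rw [this, Derivation.leibniz, Derivation.map_algebraMap]
  simp [Algebra.smul_def]

/-- Projection to degree `0` kills `𝒜_{>0}` and sends `f ^ n` to itself, while the ring is a domain.
This supplies points of the zero section where `f` does not vanish. -/
theorem notMem_radical_positiveIdeal (U : X.S.affineOpens) {f : X.A U} (hf : f ∈ X.gr U 0) (hf0 : f ≠ 0) :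
    f ∉ (X.positiveIdeal U).radical := by
  rintro ⟨n, hn⟩
  have := X.nonempty_preimage_of_ne_zero U hf0
  have h := proj_zero_of_mem (X.gr U) hn
  rw [proj_zero_eq, map_pow, ← proj_zero_eq, proj_of_mem _ hf] at h
  exact hf0 (eq_zero_of_pow_eq_zero h)

/-- The predicate that `Fit_m(𝒬(π))` has a nonzero element of degree `n` over `U`. -/
def HasFit (U : X.S.affineOpens) (m : ℤ) (n : ℕ) : Prop :=
  ∃ f ∈ X.Fit U m, f ∈ X.gr U n ∧ f ≠ 0

end

/-! ### Fitting ideals under equivariant open immersions. -/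

section

variable {k : Type u} [Field k] {r w : ℕ} {X X' : GradedCone k r w}

/-- Equivariant morphisms of cones which are open immersions over some affine open of the base
preserve the degrees of the nonzero elements of Fitting ideals. -/
theorem hasFit_iff_of_isOpenImmersion (p : X'.C ⟶ X.C) {U : X.S.affineOpens}
    {U' : X'.S.affineOpens} (h : X'.π ⁻¹ᵁ U'.1 ≤ p ⁻¹ᵁ X.π ⁻¹ᵁ U.1)
    [IsOpenImmersion ((X'.π ⁻¹ᵁ U'.1).ι ≫ p)] [Nonempty U'.1]
    (hgr : ∀ n, ∀ f ∈ X.gr U n, (p.appLE _ _ h).hom f ∈ X'.gr U' n)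
    (hco : ∀ f : X.A U, X'.coact U' ((p.appLE _ _ h).hom f) =
      MvPolynomial.map (p.appLE _ _ h).hom (X.coact U f)) (m : ℤ) (n : ℕ) :
    X.HasFit U m n ↔ X'.HasFit U' m n := by
  have := X'.nonempty_preimage U'
  have hinj := appLE_injective_of_isOpenImmersion p h
  -- The neighbourhood of `p z'` below is centred on a point `z'` of the zero section, so that `c`
  -- has a nonzero part of degree `0`: otherwise the pullback of `c` would lie in `𝒜'_{>0}` and
  -- vanish at `z'`.
  obtain ⟨z', hz', hz⟩ := exists_mem_basicOpen_of_notMem_radical (X'.isAffineOpen_preimage U')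
    (X'.positiveIdeal U') (X'.notMem_radical_positiveIdeal U' (SetLike.one_mem_graded _) one_ne_zero)
  have hz'V := X'.C.basicOpen_le _ hz'
  obtain ⟨c, hc, hzc⟩ := (X.isAffineOpen_preimage U).exists_basicOpen_le
    (V := ((X'.π ⁻¹ᵁ U'.1).ι ≫ p).opensRange) ⟨p z', ⟨⟨z', hz'V⟩, rfl⟩⟩ (h hz'V)
  have hφc : z' ∈ X'.C.basicOpen ((p.appLE _ _ h).hom c) :=
    (Scheme.basicOpen_appLE p _ _ h c).ge ⟨hz'V, hzc⟩
  have hφc' : (p.appLE _ _ h).hom c ∉ X'.positiveIdeal U' := fun hmem => hz _ hmem hφc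
  have hc0 : GradedRing.proj (X.gr U) 0 c ≠ 0 := by
    intro h0
    apply hφc'
    have := sub_proj_zero_mem (X'.gr U') ((p.appLE _ _ h).hom c)
    rwa [proj_map (X.gr U) (X'.gr U') hgr, h0, map_zero, sub_zero] at this
  have hne : (p.appLE _ _ h).hom c ≠ 0 := fun h0 => hφc' (h0 ▸ Ideal.zero_mem _)
  unfold HasFit
  rw [Fit_eq_minorIdeal, Fit_eq_minorIdeal]
  refine exists_mem_minorIdeal_iff (X.gr U) (X'.gr U') hinj hgr ?_ ?_ hc0
    (exists_pow_mul_eq_appLE p h (X.isAffineOpen_preimage U) c hc hne) m n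
  · intro a i
    rw [xi_apply, hco, MvPolynomial.coeff_map]
    rfl
  · exact fun c hc a' i => X'.xi_mul_of_mem_gr_zero U' (hgr _ _ hc) a' i

end

/-! ### Independence of the affine open of the base. -/

section

variable {k : Type u} [Field k] {r w : ℕ} (X : GradedCone k r w)

/-- Restriction of functions on `C` to a smaller affine open of `S`. -/
abbrev res {U V : X.S.affineOpens} (h : V.1 ≤ U.1) : X.A U →+* X.A V :=
  (X.C.presheaf.map (homOfLE (show X.π ⁻¹ᵁ V.1 ≤ X.π ⁻¹ᵁ U.1 from fun _ hx => h hx)).op).hom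

theorem xi_res {U V : X.S.affineOpens} (h : V.1 ≤ U.1) (f : X.A U) (i : Fin r) :
    X.xi V (X.res h f) i = X.res h (X.xi U f i) := by
  rw [xi_apply, X.coact_map, MvPolynomial.coeff_map]
  rfl

theorem appLE_id_eq_res {U V : X.S.affineOpens} (h : V.1 ≤ U.1) :
    ((𝟙 X.C : X.C ⟶ X.C).appLE (X.π ⁻¹ᵁ U.1) (X.π ⁻¹ᵁ V.1) (fun _ hx => h hx)).hom = X.res h := by
  simp only [Scheme.Hom.appLE, Scheme.Hom.id_app]
  exact congrArg CommRingCat.Hom.hom (Category.id_comp _)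

theorem hasFit_iff_of_le {U V : X.S.affineOpens} (h : V.1 ≤ U.1) [Nonempty V.1] (m : ℤ) (n : ℕ) :
    X.HasFit U m n ↔ X.HasFit V m n := by
  have h' : X.π ⁻¹ᵁ V.1 ≤ (𝟙 X.C) ⁻¹ᵁ X.π ⁻¹ᵁ U.1 := fun _ hx => h hx
  have e : ((𝟙 X.C : X.C ⟶ X.C).appLE _ _ h').hom = X.res h := by
    exact X.appLE_id_eq_res h
  refine hasFit_iff_of_isOpenImmersion (𝟙 X.C) h' ?_ ?_ m n
  · rw [e]
    exact fun n f hf => X.map_mem_gr _ hf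
  · rw [e]
    exact fun f => X.coact_map _ f

theorem exists_affineOpens_le {U : X.S.Opens} (x : X.S) (hx : x ∈ U) :
    ∃ V : X.S.affineOpens, V.1 ≤ U ∧ x ∈ V.1 := by
  obtain ⟨_, ⟨V, hV, rfl⟩, hxV, hVU⟩ := X.S.isBasis_affineOpens.exists_subset_of_mem_open hx U.2
  exact ⟨⟨V, hV⟩, hVU, hxV⟩

/-- Since `S` is irreducible, `U` and `V` contain a common nonempty affine open. -/
theorem hasFit_iff (U V : X.S.affineOpens) [hU : Nonempty U.1] [hV : Nonempty V.1] (m : ℤ) (n : ℕ) :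
    X.HasFit U m n ↔ X.HasFit V m n := by
  obtain ⟨x, hx⟩ := nonempty_preirreducible_inter U.1.2 V.1.2
    (Set.nonempty_coe_sort.1 hU) (Set.nonempty_coe_sort.1 hV)
  obtain ⟨W, hW, hxW⟩ := X.exists_affineOpens_le (U := U.1 ⊓ V.1) x hx
  have : Nonempty W.1 := ⟨⟨x, hxW⟩⟩
  rw [X.hasFit_iff_of_le (hW.trans inf_le_left), X.hasFit_iff_of_le (hW.trans inf_le_right)]

theorem evaluation_res {V W : X.C.Opens} (h : W ≤ V) (x : X.C) (hx : x ∈ W)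
    (f : Γ(X.C, V)) : (X.C.evaluation W x hx).hom ((X.C.presheaf.map (homOfLE h).op).hom f) =
      (X.C.evaluation V x (h hx)).hom f := by
  have : X.C.presheaf.map (homOfLE h).op ≫ X.C.evaluation W x hx =
      X.C.evaluation V x (h hx) := by
    rw [← Scheme.germ_residue, ← Scheme.germ_residue, X.C.presheaf.germ_res_assoc]
  exact congr($(this).hom f)

/-- A point lies in the zero section if functions of positive degree over some affine open of `S`
vanish. -/
theorem mem_zeroSection_of_forall {x : X.C} (U : X.S.affineOpens) (hx : x ∈ X.π ⁻¹ᵁ U.1)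
    (h : ∀ f ∈ X.positiveIdeal U, (X.C.evaluation _ x hx).hom f = 0) : x ∈ X.zeroSection := by
  intro U' hx' f hf
  suffices X.positiveIdeal U' ≤ RingHom.ker (X.C.evaluation _ x hx').hom from this hf
  refine Ideal.span_le.2 ?_
  rintro f ⟨n, hn, hf⟩
  obtain ⟨g, g', hgg, hxg⟩ := exists_basicOpen_le_affine_inter U.2 U'.2 (X.π x) ⟨hx, hx'⟩
  obtain ⟨V, hV⟩ : ∃ V : X.S.affineOpens, V.1 = X.S.basicOpen g := ⟨⟨_, U.2.basicOpen g⟩, rfl⟩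
  have hVU : V.1 ≤ U.1 := hV.trans_le (X.S.basicOpen_le g)
  have hVU' : V.1 ≤ U'.1 := (hV.trans hgg).trans_le (X.S.basicOpen_le g')
  have hxV : x ∈ X.π ⁻¹ᵁ V.1 := hV.ge hxg
  obtain ⟨c, hcdef⟩ : ∃ c : X.A U, c = (X.π.app U.1).hom g := ⟨_, rfl⟩
  have hcV : X.C.basicOpen c = X.π ⁻¹ᵁ V.1 := by
    rw [hV, hcdef]; exact (Scheme.preimage_basicOpen X.π g).symm
  have hc0 : (X.C.evaluation _ x hx).hom c ≠ 0 :=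
    (Scheme.evaluation_ne_zero_iff_mem_basicOpen _ x hx c).2 (hcV ▸ hxV)
  have hres : ∀ a : X.A U, (X.C.evaluation _ x hxV).hom (X.res hVU a) =
    (X.C.evaluation _ x hx).hom a := X.evaluation_res _ x hxV
  have hc := (X.mem_gr_zero_iff U c).2 ⟨g, hcdef.symm⟩
  -- On a common principal open `V`, `f` is a fraction `b / c ^ N` with `c` of degree `0`. Then `b`
  -- may be replaced by its component of degree `n > 0`, which vanishes at `x` by assumption,
  -- whereas `c` does not.
  obtain ⟨N, b, hb⟩ := exists_pow_mul_eq_appLE (𝟙 X.C) (U := X.π ⁻¹ᵁ U.1) (V := X.π ⁻¹ᵁ V.1)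
    (fun _ hx => hVU hx) (X.isAffineOpen_preimage U) c (by simp [hcV])
    (by
      rw [X.appLE_id_eq_res hVU]
      intro h0
      have := hres c
      rw [h0, map_zero] at this
      exact hc0 this.symm) (X.res hVU' f)
  rw [X.appLE_id_eq_res hVU, ← map_pow] at hb
  have hfn : X.res hVU' f ∈ X.gr V n := X.map_mem_gr _ hf
  have hcN : X.res hVU (c ^ N) ∈ X.gr V 0 := by
    refine X.map_mem_gr _ ?_
    have := SetLike.pow_mem_graded N hc
    rwa [smul_zero] at this
  have hmem : X.res hVU (c ^ N) * X.res hVU' f ∈ X.gr V n := by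
    have := SetLike.mul_mem_graded hcN hfn
    rwa [zero_add] at this
  have hproj := proj_of_mem (X.gr V) hmem
  rw [hb, proj_map (X.gr U) (X.gr V) (fun n a ha => X.map_mem_gr _ ha), ← hb] at hproj
  have := congrArg (X.C.evaluation _ x hxV).hom hproj
  rw [hres, h _ (Ideal.subset_span ⟨n, hn, proj_mem _ _ _⟩), map_mul, hres, map_pow,
    X.evaluation_res (V := X.π ⁻¹ᵁ U'.1) _ x hxV f] at this
  exact (mul_eq_zero.1 this.symm).resolve_left (pow_ne_zero _ hc0)

end

end GradedCone

end GradedAdditive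

namespace GradedAdditive

namespace GradedCone

/-! ### Stabilisers at closed points and the value of `d(π)`. -/

section

variable {k : Type u} [Field k] {r w : ℕ} (X : GradedCone k r w)

/-- The subspace of those `∑ c_i ξ_i` whose vector field over `U` vanishes at `x`. -/
def stabOn (x : X.C) (U : X.S.affineOpens) (hx : x ∈ X.π ⁻¹ᵁ U.1) : Submodule k (Fin r → k) where
  carrier := {c | ∀ f : X.A U,
    (X.C.evaluation _ x hx).hom (∑ i, X.const U (c i) * X.xi U f i) = 0}
  zero_mem' := fun f => by simp
  add_mem' := fun {a b} ha hb f => by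
    have h1 := ha f
    have h2 := hb f
    simp only [Pi.add_apply, map_add, add_mul, Finset.sum_add_distrib] at *
    rw [h1, h2, add_zero]
  smul_mem' := fun c a ha f => by
    have h1 := ha f
    simp only [Pi.smul_apply, smul_eq_mul, map_mul, mul_assoc, ← Finset.mul_sum]
    rw [h1, mul_zero]

theorem mem_stab_iff (x : X.C) (c : Fin r → k) :
    c ∈ X.stab x ↔ ∀ (U : X.S.affineOpens) (hx : x ∈ X.π ⁻¹ᵁ U.1), c ∈ X.stabOn x U hx := Iff.rfl

theorem res_const {U V : X.S.affineOpens} (h : V.1 ≤ U.1) (c : k) :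
    X.res h (X.const U c) = X.const V c := by
  unfold const
  have : ((Scheme.ΓSpecIso (CommRingCat.of k)).inv ≫
      (X.π ≫ X.str).appLE ⊤ (X.π ⁻¹ᵁ U.1) (by simp)) ≫
      X.C.presheaf.map (homOfLE (show X.π ⁻¹ᵁ V.1 ≤ X.π ⁻¹ᵁ U.1 from fun _ hx => h hx)).op =
      (Scheme.ΓSpecIso (CommRingCat.of k)).inv ≫
      (X.π ≫ X.str).appLE ⊤ (X.π ⁻¹ᵁ V.1) (by simp) := by
    rw [Category.assoc]
    exact congrArg (_ ≫ ·) (Scheme.Hom.appLE_map (X.π ≫ X.str) (U := ⊤) (V := X.π ⁻¹ᵁ U.1)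
      (fun _ _ => trivial) _)
  exact congr($(this).hom c)

/-- There are more functions over the smaller open, hence more conditions on `c`. -/
theorem stabOn_le_of_le {x : X.C} {U V : X.S.affineOpens} (h : V.1 ≤ U.1) (hx : x ∈ X.π ⁻¹ᵁ U.1)
    (hxV : x ∈ X.π ⁻¹ᵁ V.1) : X.stabOn x V hxV ≤ X.stabOn x U hx := by
  intro c hc f
  have := hc (X.res h f)
  simp only [xi_res, ← X.res_const h, ← map_mul, ← map_sum] at this
  rwa [X.evaluation_res _ x hxV] at this

/-- The stabiliser of `x` is computed on a small enough affine open of `S`. -/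
theorem exists_stab_eq_stabOn (x : X.C) :
    ∃ (U : X.S.affineOpens) (hx : x ∈ X.π ⁻¹ᵁ U.1), X.stab x = X.stabOn x U hx := by
  let T : Set (Submodule k (Fin r → k)) :=
    {p | ∃ (U : X.S.affineOpens) (hx : x ∈ X.π ⁻¹ᵁ U.1), p = X.stabOn x U hx}
  have hT : T.Nonempty := by
    obtain ⟨U, -, hU⟩ := X.exists_affineOpens_le (U := ⊤) (X.π x) trivial
    exact ⟨_, U, hU, rfl⟩
  -- By finite dimension some `U` has a minimal `stabOn`; shrinking `U` no longer changes it, so it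
  -- lies in every other one.
  obtain ⟨p, ⟨U, hx, rfl⟩, hmin⟩ := wellFounded_lt.has_min T hT
  refine ⟨U, hx, le_antisymm (fun c hc => hc U hx) fun c hc => ?_⟩
  rw [mem_stab_iff]
  intro U' hx'
  obtain ⟨V, hV, hxV⟩ := X.exists_affineOpens_le (U := U.1 ⊓ U'.1) (X.π x) ⟨hx, hx'⟩
  have h1 := X.stabOn_le_of_le (hV.trans inf_le_left) hx hxV
  have h2 := X.stabOn_le_of_le (hV.trans inf_le_right) hx' hxV
  have h3 : X.stabOn x V hxV = X.stabOn x U hx := by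
    by_contra hne
    exact hmin _ ⟨V, hxV, rfl⟩ (lt_of_le_of_ne h1 hne)
  exact h2 (h3 ▸ hc)

/-- The stabiliser is the solution space of the linear system with rows `ξ f` evaluated at `x`, so
its dimension is `r` minus the rank, and the rank is detected by minors. -/
theorem finrank_stabOn_le_iff [IsAlgClosed k] {x : X.C} (hcl : IsClosed {x}) (U : X.S.affineOpens)
    (hx : x ∈ X.π ⁻¹ᵁ U.1) (m : ℕ) : Module.finrank k (X.stabOn x U hx) ≤ m ↔
      ∃ (g : Fin ((r : ℤ) - m).toNat → X.A U) (c : Fin ((r : ℤ) - m).toNat → Fin r),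
        (Matrix.of fun i j => (X.C.evaluation _ x hx).hom (X.xi U (g i) (c j))).det ≠ 0 := by
  set ev := (X.C.evaluation _ x hx).hom
  -- The residue field at a closed point is `k`; transport along this identification puts the system
  -- over `k`.
  have hbij : Function.Bijective (ev.comp (X.const U)) := by
    have h := const_evaluation (X.π ≫ X.str) (X.π ⁻¹ᵁ U.1) x hx (by simp) hcl
    have h1 : IsIso ((Scheme.ΓSpecIso (CommRingCat.of k)).inv ≫
      (X.π ≫ X.str).appLE ⊤ (X.π ⁻¹ᵁ U.1) (by simp) ≫ X.C.evaluation _ x hx) := by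
      rw [h]; infer_instance
    exact (ConcreteCategory.isIso_iff_bijective _).1 h1
  let σ := RingEquiv.ofBijective _ hbij
  let v : X.A U → Fin r → k := fun f i => σ.symm (ev (X.xi U f i))
  have h1 := finrank_add_finrank_span_eq v (X.stabOn x U hx) (fun c => by
    refine forall_congr' fun f => ?_
    rw [← map_eq_zero_iff σ σ.injective]
    simp only [map_sum, map_mul, v, RingEquiv.apply_symm_apply]
    rfl)
  have h2 := exists_minor_ne_zero_iff v ((r : ℤ) - m).toNat
  have h3 : ∀ (g : Fin ((r : ℤ) - m).toNat → X.A U) (c : Fin ((r : ℤ) - m).toNat → Fin r),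
      (Matrix.of fun i j => ev (X.xi U (g i) (c j))).det =
        σ (Matrix.of fun i j => v (g i) (c j)).det := by
    intro g c
    rw [RingEquiv.map_det]
    congr 1
    ext i j
    simp [v]
  simp only [h3, ne_eq, map_eq_zero_iff σ σ.injective]
  rw [h2]
  -- For `m > r` the size of the minors truncates to `0`, and both sides hold.
  omega

theorem exists_hasFit_of_finrank_le [IsAlgClosed k] {z : X.C} (hz : z ∈ X.zeroSection)
    (hcl : IsClosed {z}) {m : ℕ} (h : Module.finrank k (X.stab z) ≤ m) :
    ∃ U : X.S.affineOpens, Nonempty U.1 ∧ X.HasFit U m 0 := by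
  obtain ⟨U, hx, hU⟩ := X.exists_stab_eq_stabOn z
  rw [hU, X.finrank_stabOn_le_iff hcl] at h
  obtain ⟨f, hf, hf0, hne⟩ := (exists_mem_minorIdeal_zero (X.gr U)
    (ξ := (X.xi U : X.A U →+ (Fin r → X.A U))) (X.xi_degree U) (X.C.evaluation _ z hx).hom
    (fun n hn a ha => hz U hx a (Ideal.subset_span ⟨n, hn, ha⟩)) m).2 h
  refine ⟨U, ⟨⟨_, hx⟩⟩, f, ?_, hf0, ?_⟩
  · rw [Fit_eq_minorIdeal]; exact hf
  · rintro rfl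
    exact hne (map_zero _)

theorem exists_finrank_le_of_hasFit [IsAlgClosed k] {U : X.S.affineOpens} {m : ℕ}
    (h : X.HasFit U m 0) :
    ∃ z ∈ X.zeroSection, IsClosed {z} ∧ Module.finrank k (X.stab z) ≤ m := by
  obtain ⟨f, hf, hf0, hne⟩ := h
  obtain ⟨z₀, hz₀, hz₀I⟩ := exists_mem_basicOpen_of_notMem_radical (X.isAffineOpen_preimage U)
    (X.positiveIdeal U) (X.notMem_radical_positiveIdeal U hf0 hne)
  -- The part of the zero section over `U` where `f` does not vanish. Being locally closed and
  -- nonempty in a Jacobson space, it contains a point closed in all of `C`.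
  let T : Set X.C := X.C.basicOpen f ∩ ⋂ g ∈ X.positiveIdeal U, (X.C.basicOpen g : Set X.C)ᶜ
  have hT : IsLocallyClosed T := by
    refine (X.C.basicOpen f).2.isLocallyClosed.inter (IsClosed.isLocallyClosed ?_)
    exact isClosed_biInter fun g _ => (X.C.basicOpen g).2.isClosed_compl
  obtain ⟨z, ⟨hzf, hzI⟩, hcl⟩ := nonempty_inter_closedPoints
    (⟨z₀, hz₀, by simpa using hz₀I⟩ : T.Nonempty) hT
  have hzU : z ∈ X.π ⁻¹ᵁ U.1 := X.C.basicOpen_le f hzf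
  have hzI' : ∀ g ∈ X.positiveIdeal U, (X.C.evaluation _ z hzU).hom g = 0 := fun g hg =>
    (Scheme.evaluation_eq_zero_iff_notMem_basicOpen _ z hzU g).2
      (by simpa using Set.mem_iInter₂.1 hzI g hg)
  refine ⟨z, X.mem_zeroSection_of_forall U hzU hzI', hcl, ?_⟩
  refine (Submodule.finrank_mono (s := X.stab z) (t := X.stabOn z U hzU) fun c hc => hc U hzU).trans ?_
  rw [X.finrank_stabOn_le_iff hcl]
  rw [Fit_eq_minorIdeal] at hf
  exact (exists_mem_minorIdeal_zero (X.gr U)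
    (ξ := (X.xi U : X.A U →+ (Fin r → X.A U))) (X.xi_degree U) (X.C.evaluation _ z hzU).hom
    (fun n hn a ha => hzI' a (Ideal.subset_span ⟨n, hn, ha⟩)) m).1
    ⟨f, hf, hf0, (Scheme.evaluation_ne_zero_iff_mem_basicOpen _ z hzU f).2 hzf⟩

/-- `d(π)` is the smallest `m` for which `Fit_m(𝒬(π))` has a nonzero element of degree zero. -/
theorem d_le_iff [IsAlgClosed k] (U : X.S.affineOpens) [Nonempty U.1] (m : ℕ) :
    X.d ≤ m ↔ X.HasFit U m 0 := by
  constructor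
  · intro h
    -- The infimum of an empty set of naturals would be `0`, so a closed point of the zero section
    -- is needed; `1 ∈ Fit_r` provides one.
    have : X.HasFit U (r : ℕ) 0 := by
      have := X.nonempty_preimage U
      refine ⟨1, ?_, SetLike.one_mem_graded _, one_ne_zero⟩
      rw [Fit_eq_minorIdeal, minorIdeal_self]
      trivial
    obtain ⟨z, hz, hcl, -⟩ := X.exists_finrank_le_of_hasFit this
    have hne : {m | ∃ z ∈ X.zeroSection, IsClosed {z} ∧
        m = Module.finrank k (X.stab z)}.Nonempty := ⟨_, z, hz, hcl, rfl⟩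
    obtain ⟨z, hz, hcl, hzd⟩ := Nat.sInf_mem hne
    obtain ⟨V, hV, hF⟩ := X.exists_hasFit_of_finrank_le hz hcl (hzd.symm.trans_le h)
    exact (X.hasFit_iff U V _ _).2 hF
  · intro h
    obtain ⟨z, hz, hcl, hm⟩ := X.exists_finrank_le_of_hasFit h
    have hd : X.d ≤ Module.finrank k (X.stab z) := Nat.sInf_le ⟨z, hz, hcl, rfl⟩
    exact hd.trans hm

/-- The index only depends on the cone over a non-empty affine open of the base. -/
theorem index_eq_of_hasFit_iff [IsAlgClosed k] {X' : GradedCone k r w} (U : X.S.affineOpens)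
    (U' : X'.S.affineOpens) [Nonempty U.1] [Nonempty U'.1]
    (h : ∀ m n, X.HasFit U m n ↔ X'.HasFit U' m n) : X'.index = X.index := by
  have hd : X'.d = X.d := by
    apply le_antisymm
    · rw [X'.d_le_iff U', ← h, ← X.d_le_iff]
    · rw [X.d_le_iff U, h, ← X'.d_le_iff]
  -- `e` ranges over all affine opens, but a nonzero function forces the open to be nonempty, so any
  -- fixed nonempty one will do.
  have key : ∀ (Y : GradedCone k r w) (V : Y.S.affineOpens), Nonempty V.1 → ∀ (m : ℤ) (n : ℕ),
      (∃ W : Y.S.affineOpens, Y.HasFit W m n) ↔ Y.HasFit V m n := by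
    intro Y V hV m n
    refine ⟨fun ⟨W, hW⟩ => ?_, fun h => ⟨V, h⟩⟩
    have : Nonempty W.1 := by
      obtain ⟨f, -, -, hf⟩ := hW
      obtain ⟨x⟩ := Y.nonempty_preimage_of_ne_zero W hf
      exact ⟨⟨_, x.2⟩⟩
    exact (Y.hasFit_iff V W m n).2 hW
  have he : X'.e = X.e := by
    unfold e
    congr 1
    ext N
    refine exists_congr fun n => and_congr_right fun _ => ?_
    exact (key X' U' ‹_› _ n).trans ((by rw [hd]; exact (h _ n).symm : _ ↔ _).trans (key X U ‹_› _ n).symm)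
  rw [index, index, hd, he]

end

end GradedCone

end GradedAdditive

namespace GradedAdditive

namespace GradedCone

section

variable {k : Type u} [Field k] {r w : ℕ} (X : GradedCone k r w)

/-! ### The blow-up away from its centre, and triviality of the centre over an open of the base. -/

section Blowup

variable (J : (U : X.S.affineOpens) → Ideal (X.A U))

/-- The complement of the closed subset of `C` cut out by `J`. -/
def coSupport : X.C.Opens := ⨆ (U : X.S.affineOpens) (h : J U), X.C.basicOpen h.1

variable {X J}

theorem mem_coSupport_iff {x : X.C} :
    x ∈ X.coSupport J ↔ ∃ (U : X.S.affineOpens), ∃ h ∈ J U, x ∈ X.C.basicOpen h := by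
  simp [coSupport]

/-- Near each point some element of `J` pulls back to a unit, so the generator `1` works. -/
theorem pullbackInvertible_of_forall_mem {T : Scheme.{u}} (f : T ⟶ X.C)
    (hf : ∀ t, f t ∈ X.coSupport J) : X.PullbackInvertible J f := by
  intro t
  obtain ⟨U, h, hJ, hx⟩ := mem_coSupport_iff.1 (hf t)
  obtain ⟨_, ⟨V, hV, rfl⟩, htV, hVU⟩ := T.isBasis_affineOpens.exists_subset_of_mem_open
    (show t ∈ ((f ⁻¹ᵁ X.C.basicOpen h : T.Opens) : Set T) from hx) (f ⁻¹ᵁ X.C.basicOpen h).2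
  have hVU' : V ≤ f ⁻¹ᵁ X.C.basicOpen h := hVU
  have hle : V ≤ f ⁻¹ᵁ X.π ⁻¹ᵁ U.1 := fun x hx => X.C.basicOpen_le h (hVU hx)
  refine ⟨⟨V, hV⟩, U, hle, 1, htV, one_mem _, ?_⟩
  rw [Ideal.span_singleton_one]
  refine Ideal.eq_top_of_isUnit_mem _ (Ideal.mem_map_of_mem _ hJ) ?_
  have e : f.appLE (X.π ⁻¹ᵁ U.1) V hle = X.C.presheaf.map (homOfLE (X.C.basicOpen_le h)).op ≫
      f.appLE (X.C.basicOpen h) V hVU' := by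
    rw [Scheme.Hom.map_appLE]
  rw [e]
  exact (RingedSpace.isUnit_res_basicOpen X.C.toRingedSpace h).map (f.appLE _ V hVU').hom

/-- The blow-up is an isomorphism away from its centre. -/
theorem IsBlowup.isOpenImmersion {B : Scheme.{u}} {b : B ⟶ X.C} (hb : X.IsBlowup J b) :
    IsOpenImmersion ((b ⁻¹ᵁ X.coSupport J).ι ≫ b) := by
  set O := X.coSupport J
  -- The universal property lifts the inclusion of `O` to `B`; its uniqueness part shows that this
  -- lift inverts `b` over `O`.
  obtain ⟨g, hg, -⟩ := hb.existsUnique_lift O.ι (pullbackInvertible_of_forall_mem _ fun t => t.2)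
  have hrange : Set.range g ⊆ Set.range (b ⁻¹ᵁ O).ι := by
    rintro _ ⟨t, rfl⟩
    have h1 : b (g t) = t.1 := by
      have := congr($hg t)
      rwa [Scheme.Hom.comp_apply] at this
    refine ⟨⟨g t, ?_⟩, rfl⟩
    change b (g t) ∈ O
    rw [h1]
    exact t.2
  have hl := IsOpenImmersion.lift_fac (b ⁻¹ᵁ O).ι g hrange
  set l := IsOpenImmersion.lift (b ⁻¹ᵁ O).ι g hrange
  have hinv : PullbackInvertible X J ((b ⁻¹ᵁ O).ι ≫ b) :=
    pullbackInvertible_of_forall_mem _ fun t => t.2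
  have h1 : (b ∣_ O) ≫ l = 𝟙 _ := by
    rw [← cancel_mono (b ⁻¹ᵁ O).ι, Category.assoc, hl, Category.id_comp]
    refine (hb.existsUnique_lift _ hinv).unique ?_ rfl
    rw [Category.assoc, hg, morphismRestrict_ι]
  have h2 : l ≫ (b ∣_ O) = 𝟙 _ := by
    rw [← cancel_mono O.ι, Category.assoc, morphismRestrict_ι, reassoc_of% hl, hg, Category.id_comp]
  have : IsIso (b ∣_ O) := ⟨l, h1, h2⟩
  rw [← morphismRestrict_ι]
  infer_instance

/-- The complement of the exceptional divisor is dense in the blow-up. -/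
theorem exists_mem_coSupport {B : Scheme.{u}} {b : B ⟶ X.C} (hb : X.PullbackInvertible J b)
    {W : B.Opens} (hW : (W : Set B).Nonempty) : ∃ v ∈ W, b v ∈ X.coSupport J := by
  obtain ⟨v₀, hv₀⟩ := hW
  obtain ⟨V, U, h, g, hv₀V, hg, hgJ⟩ := hb v₀
  obtain ⟨s, hs, hv₀s⟩ := V.2.exists_basicOpen_le ⟨v₀, hv₀⟩ hv₀V
  -- A nonzerodivisor `g` cannot vanish on a whole nonempty open: if `g * s` were nilpotent, so
  -- would be `s`.
  have hne : B.basicOpen (g * s) ≠ ⊥ := by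
    intro h0
    obtain ⟨n, hn⟩ := (Scheme.isNilpotent_iff_basicOpen_eq_bot_of_isCompact V.2.isCompact _).2 h0
    rw [mul_pow] at hn
    have hsn : s ^ n = 0 := (mul_left_mem_nonZeroDivisors_eq_zero_iff (pow_mem hg n)).1 hn
    have := (Scheme.isNilpotent_iff_basicOpen_eq_bot_of_isCompact V.2.isCompact s).1 ⟨n, hsn⟩
    rw [this] at hv₀s
    exact hv₀s
  obtain ⟨v, hv⟩ : ∃ v, v ∈ B.basicOpen (g * s) := by
    by_contra! hcon
    exact hne (by ext x; exact ⟨fun hx => hcon x hx, fun hx => hx.elim⟩)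
  rw [Scheme.basicOpen_mul] at hv
  have hvV := B.basicOpen_le _ hv.1
  refine ⟨v, hs hv.2, ?_⟩
  -- If every element of `J` vanished at `b v`, the pulled back ideal, hence its generator `g`,
  -- would vanish at `v`.
  by_contra hcon
  have hev : (J U).map (b.appLE _ V.1 h).hom ≤ RingHom.ker (B.evaluation V.1 v hvV).hom := by
    rw [Ideal.map_le_iff_le_comap]
    intro a ha
    refine (Scheme.evaluation_eq_zero_iff_notMem_basicOpen _ v hvV _).2 ?_
    erw [Scheme.basicOpen_appLE]
    exact fun hva => hcon (mem_coSupport_iff.2 ⟨U, a, ha, hva.2⟩)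
  have : g ∈ (J U).map (b.appLE _ V.1 h).hom := hgJ ▸ Ideal.mem_span_singleton_self g
  exact (Scheme.evaluation_eq_zero_iff_notMem_basicOpen _ v hvV _).1 (hev this) hv.1

end Blowup

/-- The centre of the modification is trivial over a non-empty affine open of the base. -/
theorem exists_centreI_eq_top [IsAlgClosed k] :
    ∃ U : X.S.affineOpens, Nonempty U.1 ∧ X.centreI U = ⊤ := by
  obtain ⟨U₀, -, hU₀⟩ := X.exists_affineOpens_le (U := ⊤) (Classical.arbitrary X.S) trivial
  have : Nonempty U₀.1 := ⟨⟨_, hU₀⟩⟩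
  -- By minimality of `d(π)`, `Fit_{d(π)}` contains a nonzero function from the base; `U` is the
  -- locus where it is invertible.
  obtain ⟨f, hf, hf0, hne⟩ := (X.d_le_iff U₀ X.d).1 le_rfl
  obtain ⟨s, rfl⟩ := (X.mem_gr_zero_iff U₀ f).1 hf0
  obtain ⟨U, hU⟩ : ∃ U : X.S.affineOpens, U.1 = X.S.basicOpen s := ⟨⟨_, U₀.2.basicOpen s⟩, rfl⟩
  have hle : U.1 ≤ U₀.1 := hU.trans_le (X.S.basicOpen_le s)
  refine ⟨U, ?_, ?_⟩
  · by_contra hcon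
    refine hne ?_
    rw [(basicOpen_eq_bot_iff s).1, map_zero]
    rw [← hU]
    ext x
    exact ⟨fun hx => hcon ⟨x, hx⟩, fun hx => hx.elim⟩
  have hunit : IsUnit (X.res hle ((X.π.app U₀.1).hom s)) := by
    obtain ⟨U, hUaff⟩ := U
    obtain rfl : U = X.S.basicOpen s := hU
    have e := X.π.naturality (homOfLE hle).op
    have h1 := (RingedSpace.isUnit_res_basicOpen X.S.toRingedSpace s).map
      (X.π.app (X.S.basicOpen s)).hom
    convert h1 using 1
    exact congr($(e).hom s).symm
  have hFit : X.Fit U X.d = ⊤ := by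
    refine Ideal.eq_top_of_isUnit_mem _ ?_ hunit
    rw [Fit_eq_minorIdeal] at hf ⊢
    exact map_mem_minorIdeal _ _ _ (X.xi_res hle) hf
  have hI : X.nonRegIdeal U = ⊤ := by rw [nonRegIdeal, hFit, top_sup_eq]
  have : Subsingleton (X.A U ⧸ X.nonRegIdeal U) := Ideal.Quotient.subsingleton_iff.2 hI
  rw [Ideal.eq_top_iff_one, centreI, RingHom.mem_ker]
  exact Subsingleton.elim _ _

end

end GradedCone

/-! ### Invariance of the index. -/

/-- A modification along the centre `𝒥` does not change the index. -/
theorem Modification.index_eq {k : Type u} [Field k] [IsAlgClosed k] {r w : ℕ}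
    {X X' : GradedCone k r w} (M : Modification X X' X.centreI) : X'.index = X.index := by
  have := M.isOpenImmersion
  obtain ⟨U, hU, hJ⟩ := X.exists_centreI_eq_top
  have hUO : X.π ⁻¹ᵁ U.1 ≤ X.coSupport X.centreI := fun x hx =>
    GradedCone.mem_coSupport_iff.2 ⟨U, 1, hJ ▸ trivial, by rwa [Scheme.basicOpen_one]⟩
  have hopen : ∀ V : X'.C.Opens, V ≤ (M.j ≫ M.b) ⁻¹ᵁ X.coSupport X.centreI →
      IsOpenImmersion (V.ι ≫ M.j ≫ M.b) := by
    intro V hV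
    have h1 := M.isBlowup.isOpenImmersion
    have hr : Set.range (V.ι ≫ M.j) ⊆ Set.range (M.b ⁻¹ᵁ X.coSupport X.centreI).ι := by
      rintro _ ⟨t, rfl⟩
      exact ⟨⟨M.j t.1, hV t.2⟩, rfl⟩
    have h2 := IsOpenImmersion.lift_fac (M.b ⁻¹ᵁ X.coSupport X.centreI).ι (V.ι ≫ M.j) hr
    rw [← Category.assoc, ← h2, Category.assoc]
    infer_instance
  -- The stratum is a nonempty open, so it meets the complement of the exceptional divisor.
  obtain ⟨_, ⟨c, rfl⟩, hc⟩ := GradedCone.exists_mem_coSupport M.isBlowup.invertible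
    M.isOpenStratum.1
  -- The image under `p` of the locus found above is a nonempty open of the irreducible `C`, so it
  -- meets the preimage of `U`.
  obtain ⟨c', hc'⟩ : ∃ c' : X'.C, (M.j ≫ M.b) c' ∈ X.π ⁻¹ᵁ U.1 := by
    have := hopen _ le_rfl
    have := X.nonempty_preimage U
    obtain ⟨_, ⟨t, rfl⟩, ht⟩ := nonempty_preirreducible_inter
      (((M.j ≫ M.b) ⁻¹ᵁ X.coSupport X.centreI).ι ≫ M.j ≫ M.b).opensRange.2 (X.π ⁻¹ᵁ U.1).2
      ⟨_, ⟨⟨c, hc⟩, rfl⟩⟩ (Set.nonempty_coe_sort.1 this)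
    exact ⟨t.1, ht⟩
  have hcomm : ∀ x : X'.C, X.π ((M.j ≫ M.b) x) = M.q (X'.π x) := by
    intro x
    have := congr($(M.comm) x)
    rwa [Scheme.Hom.comp_apply, Scheme.Hom.comp_apply X'.π] at this
  obtain ⟨U', hU', hcU'⟩ := X'.exists_affineOpens_le (U := M.q ⁻¹ᵁ U.1) (X'.π c')
    (show M.q (X'.π c') ∈ U.1 from hcomm c' ▸ hc')
  have hU'ne : Nonempty U'.1 := ⟨⟨_, hcU'⟩⟩
  have hle : X'.π ⁻¹ᵁ U'.1 ≤ (M.j ≫ M.b) ⁻¹ᵁ X.π ⁻¹ᵁ U.1 := fun x hx => by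
    change X.π ((M.j ≫ M.b) x) ∈ U.1
    rw [hcomm]
    exact hU' hx
  have := hopen (X'.π ⁻¹ᵁ U'.1) (fun x hx => hUO (hle hx))
  exact X.index_eq_of_hasFit_iff U U' (GradedCone.hasFit_iff_of_isOpenImmersion (M.j ≫ M.b) hle
    (fun n f hf => M.map_mem_gr U U' hle n f hf) (M.coact_map U U' hle))

end GradedAdditive

theorem corollary4p2 {k : Type u} [Field k] [IsAlgClosed k] [CharZero k] (r w : ℕ)
    (hr : 0 < r) (hw : 0 < w) (X X' : GradedAdditive.GradedCone k r w) (M : GradedAdditive.Modification X X' X.centreI) :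
    X'.index ≤ X.index ∧ X'.index = X.index := by
  exact ⟨M.index_eq.le, M.index_eq⟩
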